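/- Let $F$ be a field, and let $(A,\sigma)$ be a quaternion $F$-algebra with involution: $A$ is a finite-dimensional simple $F$-algebra whose centre $K=Z(A)$ satisfies $\dim_K A=4$, and $\sigma:A\to A$ is an additive, anti-multiplicative map with $\sigma^2=\mathrm{id}_A$ such that $F=K\cap \mathrm{Sym}(A,\sigma)$, where $\mathrm{Sym}(A,\sigma)=\{x\in A\mid \sigma(x)=x\}$ (so $\sigma$ may be of the first or of the second kind). A prepositive cone on $(A,\sigma)$ is a subset $\mathscr P\subseteq \mathrm{Sym}(A,\sigma)$ such that (P1) $\mathscr P\neq\varnothing$; (P2) $\mathscr P+\mathscr P\subseteq\mathscr P$; (P3) $\sigma(x)\,\mathscr P\, x\subseteq \mathscr P$ for every $x\in A$; (P4) $\mathscr P_F:=\{u\in F\mid u\mathscr P\subseteq \mathscr P\}$ is an ordering of $F$; (P5) $\mathscr P\cap-\mathscr P=\{0\}$. It is over an ordering $P$ of $F$ if $\mathscr P_F=P$. A positive cone is a prepositive cone that is maximal with respect to inclusion among all prepositive cones on $(A,\sigma)$. Theorem. Let $P$ be an ordering of $F$ and let $F_P$ be a real closure of $F$ at $P$. If $F$ is dense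 in $F_P$ for the order topology of $F_P$, then every prepositive cone on $(A,\sigma)$ over $P$ is maximal, i.e. is a positive cone. -/

import Mathlib

/-- `(A, σ)` is an `F`-algebra with involution, where `σ` is the `star` operation of `A` (additive,
anti-multiplicative and of order at most two): `A` is a finite-dimensional simple `F`-algebra, and
`F` is the set of `σ`-symmetric elements of the centre of `A`. -/
structure IsAlgebraWithInvolution (F A : Type*) [Field F] [Ring A] [Algebra F A] [StarRing A] :
    Prop where
  finiteDimensional : FiniteDimensional F A
  isSimpleRing : IsSimpleRing A
  range_algebraMap :
    Set.range (algebraMap F A) = (Subring.center A : Set A) ∩ {x | star x = x}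

/-- A quaternion `F`-algebra with involution: an `F`-algebra with involution that has dimension
four over its centre. -/
structure IsQuaternionAlgebraWithInvolution (F A : Type*) [Field F] [Ring A] [Algebra F A]
    [StarRing A] : Prop extends IsAlgebraWithInvolution F A where
  finrank_center : Module.finrank (Subring.center A) A = 4

/-- The set `𝒫_F` of all `u ∈ F` with `u 𝒫 ⊆ 𝒫`. -/
def scalarSet (F : Type*) {A : Type*} [Field F] [Ring A] [Algebra F A] (C : Set A) : Set F :=
  {u | ∀ x ∈ C, u • x ∈ C}

/-- Prepositive cones on `(A, σ)`, where `σ` is the `star` operation of `A`. -/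
structure IsPrepositiveCone (F : Type*) {A : Type*} [Field F] [Ring A] [Algebra F A] [StarRing A]
    (C : Set A) : Prop where
  isSymm : ∀ x ∈ C, star x = x
  nonempty : C.Nonempty
  add_mem : ∀ x ∈ C, ∀ y ∈ C, x + y ∈ C
  star_mul_mul_mem : ∀ a : A, ∀ x ∈ C, star a * x * a ∈ C
  isOrdering : ∃ O : RingPreordering F, O.IsOrdering ∧ (O : Set F) = scalarSet F C
  inter_neg : C ∩ {x | -x ∈ C} = {0}

/-- Positive cones: prepositive cones that are maximal, with respect to inclusion, among all
prepositive cones on `(A, σ)`. -/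
def IsPositiveCone (F : Type*) {A : Type*} [Field F] [Ring A] [Algebra F A] [StarRing A]
    (C : Set A) : Prop :=
  Maximal (IsPrepositiveCone F) C

/-- The ordered field `R` is a real closure of the field `F` at the ordering `P`: it is real closed,
algebraic over `F`, and its order restricts to `P` on `F`. -/
structure IsRealClosure {F : Type*} [Field F] (P : RingPreordering F) (R : Type*) [Field R]
    [LinearOrder R] [IsStrictOrderedRing R] [Algebra F R] : Prop where
  isRealClosed : IsRealClosed R
  isAlgebraic : Algebra.IsAlgebraic F R
  mem_iff : ∀ x : F, x ∈ P ↔ 0 ≤ algebraMap F R x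

/-!
Let `t` denote the reduced trace of `A`. The argument has two parts.

Suppose that the cone contains `1`. A symmetric element `e` with `t e = 0` has a square `δ` in `F`,
and `δ = star e * 1 * e` lies in the cone, so `δ` is nonnegative: the reduced norm form
`α + e ↦ α ^ 2 - δ` on the symmetric elements is Lorentzian
(`exists_mul_self_eq_smul_one`, `trace_zero_eq_zero_of_mul_self`). A prepositive cone
containing `1` is then squeezed between two descriptions of one half of the light cone.

* If `d = α + e` has nonnegative norm, the equation `2 α d = d ^ 2 + (α ^ 2 - δ)` places one of `d`,
  `-d` in the cone (`subset_of_one_mem`).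
* An element of a cone cannot have negative norm (`sq_sub_mem_of_mem`): conjugation by a symmetric
  `y` of trace zero that anticommutes with `e` exchanges `α + e` and `α - e` up to a positive
  factor, so that all scalar parts in the cone are nonnegative, whereas conjugation by
  `α • e - δ • 1` produces an element with scalar part `α * δ * (α ^ 2 - δ)`, which is negative
  unless `α = 0`; and if `α = 0` then both `e` and `-e` lie in the cone.

Hence a cone that contains `1` equals every cone above it, which has the same scalars by
`IsPrepositiveCone.scalarSet_eq_of_subset`.

In general, every prepositive cone contains an invertible element `c` (`exists_isUnit_mem`; this
has content only when `A` is split), and replacing `star` by `x ↦ c⁻¹ * star x * c` and the cone `C`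
by `c⁻¹ C` leads to the case `1 ∈ C`.

The existence of the reduced trace comes from Wedderburn's theorem: `A` is a matrix algebra of
degree two over its centre, or a division algebra in which every element is quadratic over the
centre (`exists_isReducedTrace`).
-/

/-! ### The reduced trace of an algebra of dimension four over its centre -/

/-- A reduced trace on a ring `A` that is quadratic over its centre `K`: a `K`-linear map
`t : A → K`, regarded as a map `A → A` with central values, that vanishes on commutators, takes
the value `2` at `1`, and makes every `x` a root of some `X ^ 2 - t x * X + n` with `n ∈ K`. -/
structure IsReducedTrace {A : Type*} [Ring A] (t : A → A) : Prop where
  mem_center : ∀ x, t x ∈ Subring.center A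
  map_add : ∀ x y, t (x + y) = t x + t y
  map_mul_left : ∀ k ∈ Subring.center A, ∀ x, t (k * x) = k * t x
  map_one : t 1 = 2
  map_mul_comm : ∀ x y, t (x * y) = t (y * x)
  mul_self : ∀ x, ∃ n ∈ Subring.center A, x * x = t x * x - n

section Existence

variable {K A : Type*} [Field K] [Ring A] [Algebra K A]

/-- In a division algebra of dimension four over its centre every element is quadratic: the
subalgebra generated by a noncentral `x` is a division ring whose dimension divides `4`, and is not
`4` because `x` commutes with it. -/
theorem exists_mul_self_eq_of_isDomain [IsDomain A] (h4 : Module.finrank K A = 4)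
    (hcen : ∀ x ∈ Subring.center A, ∃ k : K, algebraMap K A k = x) (x : A) :
    ∃ a b : K, x * x = a • x + b • (1 : A) := by
  have hfin : FiniteDimensional K A := Module.finite_of_finrank_pos (by omega)
  by_cases hx : x ∈ Subring.center A
  · obtain ⟨k, rfl⟩ := hcen x hx
    exact ⟨k, 0, by simp [Algebra.smul_def]⟩
  have hx' : ∀ k : K, algebraMap K A k ≠ x := by
    rintro k rfl
    exact hx (Subring.mem_center_iff.2 fun g => (Algebra.commutes k g).symm)
  set E := Algebra.adjoin K {x} with hE
  have hxE : x ∈ E := Algebra.self_mem_adjoin_singleton K x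
  let _ : DivisionRing E := divisionRingOfFiniteDimensional K E
  have hmul : Module.finrank K E * Module.finrank E A = 4 := by
    rw [Module.finrank_mul_finrank, h4]
  have hne : Module.finrank K E ≠ 4 := by
    intro h
    have htop : E = ⊤ := by
      apply Subalgebra.eq_of_le_of_finrank_eq le_top
      rw [h, subalgebra_top_finrank_eq_submodule_top_finrank, finrank_top, h4]
    refine hx (Subring.mem_center_iff.2 fun g => ?_)
    have hg : g ∈ Algebra.adjoin K {x} := by rw [← hE, htop]; trivial
    exact (Algebra.commute_of_mem_adjoin_self hg).eq.symm
  have hlt : Module.finrank K E < 3 := by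
    have hdvd : Module.finrank K E ∣ 4 := ⟨_, hmul.symm⟩
    have := Nat.le_of_dvd (by norm_num) hdvd
    interval_cases h : Module.finrank K E <;> omega
  have hdep : ¬ LinearIndependent K ![(1 : E), ⟨x, hxE⟩, ⟨x, hxE⟩ * ⟨x, hxE⟩] := by
    intro h
    have := h.fintype_card_le_finrank
    simp at this
    omega
  rw [Fintype.not_linearIndependent_iff] at hdep
  obtain ⟨g, hg, i, hi⟩ := hdep
  have hg' : g 0 • (1 : A) + g 1 • x + g 2 • (x * x) = 0 := by
    have := congrArg (Subtype.val : E → A) hg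
    simpa [Fin.sum_univ_three] using this
  by_cases h2 : g 2 = 0
  · exfalso
    by_cases h1 : g 1 = 0
    · have h0 : g 0 = 0 := by simpa [h1, h2] using hg'
      fin_cases i <;> simp_all
    · apply hx' (-(g 1)⁻¹ * g 0)
      have : g 1 • x = -(g 0 • (1 : A)) := by
        rw [eq_neg_iff_add_eq_zero, add_comm]; simpa [h2] using hg'
      rw [Algebra.algebraMap_eq_smul_one, neg_mul, neg_smul, mul_smul, ← smul_neg, ← this,
        smul_smul, inv_mul_cancel₀ h1, one_smul]
  · refine ⟨-(g 2)⁻¹ * g 1, -(g 2)⁻¹ * g 0, ?_⟩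
    have : g 2 • (x * x) = -(g 1 • x + g 0 • (1 : A)) := by
      rw [eq_neg_iff_add_eq_zero, ← hg']; abel
    rw [← one_smul K (x * x), ← inv_mul_cancel₀ h2, mul_smul, this]
    module

/-- In a division algebra of dimension four, half the trace of left multiplication is a reduced
trace: a noncentral `s` with central square anticommutes with every commutator `s * z - z * s`, so
it is conjugate to `-s` and left multiplication by `s` has trace zero. -/
theorem exists_trace_of_isDomain [IsDomain A] (h2 : (2 : K) ≠ 0) (h4 : Module.finrank K A = 4)
    (hcen : ∀ x ∈ Subring.center A, ∃ k : K, algebraMap K A k = x) :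
    ∃ τ : A →ₗ[K] K, τ 1 = 2 ∧ (∀ x y, τ (x * y) = τ (y * x)) ∧
      ∀ x, ∃ n : K, x * x = τ x • x - n • (1 : A) := by
  have hfin : FiniteDimensional K A := Module.finite_of_finrank_pos (by omega)
  let T : A →ₗ[K] K := LinearMap.trace K A ∘ₗ (Algebra.lmul K A).toLinearMap
  have hcomm : ∀ x y, T (x * y) = T (y * x) := fun x y => by
    simp only [T, LinearMap.comp_apply, AlgHom.toLinearMap_apply, map_mul]
    exact LinearMap.trace_mul_comm _ _ _
  have hone : T 1 = 4 := by
    simp only [T, LinearMap.comp_apply, AlgHom.toLinearMap_apply, _root_.map_one]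
    rw [LinearMap.trace_one, h4]
    norm_num
  have hzero : ∀ (s : A) (δ : K), (∀ k : K, algebraMap K A k ≠ s) → s * s = δ • (1 : A) →
      T s = 0 := by
    intro s δ hs hss
    have hsc : s ∉ Subring.center A := fun h => by
      obtain ⟨k, hk⟩ := hcen s h
      exact hs k hk
    rw [Subring.mem_center_iff] at hsc
    push Not at hsc
    obtain ⟨z, hz⟩ := hsc
    have hw : s * z - z * s ≠ 0 := sub_ne_zero.2 hz.symm
    have hanti : s * (s * z - z * s) = -((s * z - z * s) * s) := by
      have h1 : s * (s * z) = δ • z := by rw [← mul_assoc, hss]; simp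
      have h2 : z * s * s = δ • z := by rw [mul_assoc, hss]; simp
      rw [mul_sub, sub_mul, h1, h2]
      noncomm_ring
    obtain ⟨w, hw⟩ := FiniteDimensional.isUnit K hw
    rw [← hw] at hanti
    have hconj : T s = -T s := by
      conv_lhs => rw [show s = s * w * ↑w⁻¹ by simp, hanti, neg_mul, map_neg, hcomm]
      simp
    have : (2 : K) * T s = 0 := by linear_combination hconj
    exact (mul_eq_zero.1 this).resolve_left h2
  refine ⟨(2 : K)⁻¹ • T, ?_, ?_, ?_⟩
  · simp only [LinearMap.smul_apply, hone, smul_eq_mul]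
    rw [show (4 : K) = 2 * 2 by norm_num]
    field_simp
  · intro x y
    simp [hcomm x y]
  · intro x
    obtain ⟨a, b, hab⟩ := exists_mul_self_eq_of_isDomain h4 hcen x
    by_cases hx : ∃ k : K, algebraMap K A k = x
    · obtain ⟨k, rfl⟩ := hx
      refine ⟨k * k, ?_⟩
      have : T (algebraMap K A k) = 4 * k := by
        rw [Algebra.algebraMap_eq_smul_one, map_smul, hone, smul_eq_mul, mul_comm]
      rw [LinearMap.smul_apply, this]
      simp only [Algebra.algebraMap_eq_smul_one, smul_eq_mul,
        smul_mul_smul_comm, one_mul, smul_smul, ← sub_smul]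
      congr 1
      field_simp
      ring
    · push Not at hx
      have htr : T (x - (2⁻¹ * a) • (1 : A)) = 0 := by
        refine hzero _ (b + 2⁻¹ * 2⁻¹ * a * a) (fun k hk => hx (k + 2⁻¹ * a) ?_) ?_
        · rw [map_add, hk, Algebra.algebraMap_eq_smul_one (2⁻¹ * a)]
          abel
        · simp only [mul_sub, sub_mul, hab, smul_mul_assoc, mul_smul_comm, one_mul, mul_one]
          match_scalars <;> field_simp <;> ring
      have hTx : (2 : K)⁻¹ * T x = a := by
        rw [map_sub, map_smul, hone, sub_eq_zero] at htr
        rw [htr, smul_eq_mul]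
        field_simp
        ring
      refine ⟨-b, ?_⟩
      rw [LinearMap.smul_apply, smul_eq_mul, hTx, hab]
      module

theorem exists_trace_of_algEquiv_matrix (e : A ≃ₐ[K] Matrix (Fin 2) (Fin 2) K) :
    ∃ τ : A →ₗ[K] K, τ 1 = 2 ∧ (∀ x y, τ (x * y) = τ (y * x)) ∧
      ∀ x, ∃ n : K, x * x = τ x • x - n • (1 : A) := by
  refine ⟨Matrix.traceLinearMap (Fin 2) K K ∘ₗ e.toLinearMap, ?_, ?_, ?_⟩
  · simp
  · intro x y
    simp [Matrix.trace_mul_comm (e x) (e y)]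
  · intro x
    refine ⟨(e x).det, e.injective ?_⟩
    ext i j
    fin_cases i <;> fin_cases j <;>
      simp [Matrix.mul_apply, Matrix.trace, Matrix.det_fin_two] <;> ring

/-- By Wedderburn's theorem an algebra of dimension four over its centre is a division algebra or
a matrix algebra of degree two over the centre. -/
theorem exists_trace_of_isSimpleRing [IsSimpleRing A] (h2 : (2 : K) ≠ 0)
    (h4 : Module.finrank K A = 4)
    (hcen : ∀ x ∈ Subring.center A, ∃ k : K, algebraMap K A k = x) :
    ∃ τ : A →ₗ[K] K, τ 1 = 2 ∧ (∀ x y, τ (x * y) = τ (y * x)) ∧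
      ∀ x, ∃ n : K, x * x = τ x • x - n • (1 : A) := by
  have hfin : FiniteDimensional K A := Module.finite_of_finrank_pos (by omega)
  have : IsArtinianRing A := IsArtinianRing.of_finite K A
  obtain ⟨n, hn, D, _, _, _, ⟨e⟩⟩ := IsSimpleRing.exists_algEquiv_matrix_divisionRing_finite K A
  have hdim : n * n * Module.finrank K D = 4 := by
    rw [← h4, e.toLinearEquiv.finrank_eq, Module.finrank_matrix]
    simp
  have hn0 : n ≠ 0 := hn.out
  have hn2 : n ≤ 2 := by
    by_contra! h
    have h9 : 9 ≤ n * n := by nlinarith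
    have hD : Module.finrank K D ≠ 0 := by rintro h; simp [h] at hdim
    have : 9 * 1 ≤ n * n * Module.finrank K D := Nat.mul_le_mul h9 (by omega)
    omega
  have hn12 : n = 1 ∨ n = 2 := by omega
  -- `n = 1` is the case of a division algebra, and for `n = 2` the division ring is the centre.
  rcases hn12 with rfl | rfl
  · have hdom : IsDomain A := by
      have : NoZeroDivisors A := ⟨by
        intro a b hab
        have h : e a 0 0 * e b 0 0 = 0 := by
          have := congrFun (congrFun (congrArg e hab) 0) 0
          simpa [Matrix.mul_apply] using this
        have key : ∀ x, e x 0 0 = 0 → x = 0 := fun x hx => e.injective (by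
          ext i j
          rw [Subsingleton.elim i 0, Subsingleton.elim j 0, hx]
          simp)
        exact (mul_eq_zero.1 h).imp (key a) (key b)⟩
      exact NoZeroDivisors.to_isDomain A
    exact exists_trace_of_isDomain h2 h4 hcen
  · have h1 : Module.finrank K D = 1 := by omega
    have hbij : Function.Bijective (Algebra.ofId K D) :=
      Algebra.bijective_algebraMap_iff.2 (Subalgebra.bot_eq_top_of_finrank_eq_one h1).symm
    exact exists_trace_of_algEquiv_matrix
      (e.trans (AlgEquiv.ofBijective (Algebra.ofId K D) hbij).symm.mapMatrix)

end Existence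

theorem exists_isReducedTrace {A : Type*} [Ring A] [IsSimpleRing A] (h2 : (2 : A) ≠ 0)
    (h4 : Module.finrank (Subring.center A) A = 4) : ∃ t : A → A, IsReducedTrace t := by
  let _ : Field (Subring.center A) := (IsSimpleRing.isField_center A).toField
  have h2' : (2 : Subring.center A) ≠ 0 := fun h => h2 (
    congrArg (Subtype.val : Subring.center A → A) h)
  obtain ⟨τ, h1, hcomm, hsq⟩ := exists_trace_of_isSimpleRing h2' h4 fun x hx => ⟨⟨x, hx⟩, rfl⟩
  refine ⟨fun x => τ x, fun x => (τ x).2, fun x y => by simp, fun k hk x => ?_, ?_,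
    fun x y => by rw [hcomm], fun x => ?_⟩
  · exact congrArg Subtype.val (τ.map_smul ⟨k, hk⟩ x)
  · rw [h1]
    rfl
  · obtain ⟨n, hn⟩ := hsq x
    refine ⟨n, n.2, ?_⟩
    rw [hn]
    congr 1
    exact mul_one _

/-- Simple rings are prime. -/
theorem IsSimpleRing.eq_zero_of_forall_mul_mul_eq_zero {A : Type*} [Ring A] [IsSimpleRing A]
    {a b : A} (h : ∀ x, a * x * b = 0) (ha : a ≠ 0) : b = 0 := by
  let I : TwoSidedIdeal A := TwoSidedIdeal.mk' {a | ∀ x, a * x * b = 0} (by simp)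
    (fun {x y} hx hy z => by rw [add_mul, add_mul, hx z, hy z, add_zero])
    (fun {x} hx z => by rw [neg_mul, neg_mul, hx z, neg_zero])
    (fun {x y} hy z => by rw [mul_assoc x y z, mul_assoc x, hy z, mul_zero])
    (fun {x y} hx z => by rw [mul_assoc x y z, hx (y * z)])
  have h1 : (1 : A) ∈ I := IsSimpleRing.one_mem_of_ne_zero_mem I ha (by
    simpa [I, TwoSidedIdeal.mem_mk'] using h)
  have h1' : ∀ x, 1 * x * b = 0 := by simpa [I, TwoSidedIdeal.mem_mk'] using h1
  simpa using h1' 1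

/-! ### Reduced traces and involutions -/

namespace IsReducedTrace

variable {A : Type*} [Ring A] {t : A → A}

theorem map_zero (ht : IsReducedTrace t) : t 0 = 0 := by
  simpa using ht.map_add 0 0

theorem map_neg (ht : IsReducedTrace t) (x : A) : t (-x) = -t x := by
  have := ht.map_add x (-x)
  rw [add_neg_cancel, ht.map_zero] at this
  exact (neg_eq_of_add_eq_zero_right this.symm).symm

theorem map_sub (ht : IsReducedTrace t) (x y : A) : t (x - y) = t x - t y := by
  rw [sub_eq_add_neg, ht.map_add, ht.map_neg, sub_eq_add_neg]

theorem map_central (ht : IsReducedTrace t) {k : A} (hk : k ∈ Subring.center A) :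
    t k = 2 * k := by
  have := ht.map_mul_left k hk 1
  rw [mul_one, ht.map_one] at this
  rw [this, mul_two, two_mul]

theorem map_smul (ht : IsReducedTrace t) {F : Type*} [Field F] [Algebra F A] (u : F) (x : A) :
    t (u • x) = u • t x := by
  rw [Algebra.smul_def, Algebra.smul_def]
  exact ht.map_mul_left _ (Subring.mem_center_iff.2 fun g => (Algebra.commutes u g).symm) _

theorem map_smul_one (ht : IsReducedTrace t) {F : Type*} [Field F] [Algebra F A] (u : F) :
    t (u • (1 : A)) = (2 * u) • (1 : A) := by
  rw [ht.map_smul, ht.map_one, mul_comm, mul_smul, two_smul F (1 : A), one_add_one_eq_two]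

end IsReducedTrace

theorem star_mem_center {A : Type*} [Ring A] [StarRing A] {k : A}
    (hk : k ∈ Subring.center A) : star k ∈ Subring.center A :=
  Subring.mem_center_iff.2 fun g => by
    rw [← star_star g, ← star_mul, ← star_mul, Subring.mem_center_iff.1 hk]

section Simple

variable {A : Type*} [Ring A] [IsSimpleRing A] {t : A → A}

theorem isUnit_of_mem_center {k : A} (hk : k ∈ Subring.center A) (h0 : k ≠ 0) : IsUnit k := by
  obtain ⟨b, hb⟩ := (IsSimpleRing.isField_center A).mul_inv_cancel
    (a := (⟨k, hk⟩ : Subring.center A)) (fun h => h0 (congrArg Subtype.val h))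
  have hb' : k * b = 1 := congrArg Subtype.val hb
  exact ⟨⟨k, b, hb', by rw [← hb', Subring.mem_center_iff.1 hk]⟩, rfl⟩

theorem mul_self_eq_of_not_isUnit (ht : IsReducedTrace t) {x : A} (hx : ¬ IsUnit x) :
    x * x = t x * x := by
  obtain ⟨n, hn, h⟩ := ht.mul_self x
  by_cases h0 : n = 0
  · rw [h, h0, sub_zero]
  exfalso
  obtain ⟨u, hu⟩ := isUnit_of_mem_center hn h0
  have htx := Subring.mem_center_iff.1 (ht.mem_center x) x
  have h1 : x * (t x - x) = u := by rw [mul_sub, htx, h, hu]; abel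
  have h2 : (t x - x) * x = u := by rw [sub_mul, h, hu]; abel
  refine hx (isUnit_iff_exists_and_exists.2 ⟨⟨(t x - x) * ↑u⁻¹, ?_⟩, ⟨↑u⁻¹ * (t x - x), ?_⟩⟩)
  · rw [← mul_assoc, h1, Units.mul_inv]
  · rw [mul_assoc, h2, Units.inv_mul]

/-- The trace form is nondegenerate, because its radical is a proper two-sided ideal. -/
theorem eq_zero_of_forall_trace_mul_eq_zero (ht : IsReducedTrace t) (h2 : (2 : A) ≠ 0) {a : A}
    (h : ∀ x, t (x * a) = 0) : a = 0 := by
  by_contra ha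
  let I : TwoSidedIdeal A := TwoSidedIdeal.mk' {a | ∀ x, t (x * a) = 0}
    (by simp [ht.map_zero])
    (fun {x y} hx hy z => by rw [mul_add, ht.map_add, hx z, hy z, add_zero])
    (fun {x} hx z => by rw [mul_neg, ht.map_neg, hx z, neg_zero])
    (fun {x y} hy z => by rw [← mul_assoc, hy (z * x)])
    (fun {x y} hx z => by rw [← mul_assoc, ht.map_mul_comm, ← mul_assoc, hx (y * z)])
  have h1 : (1 : A) ∈ I := IsSimpleRing.one_mem_of_ne_zero_mem I ha (by
    simpa [I, TwoSidedIdeal.mem_mk'] using h)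
  have h1' : ∀ x, t (x * 1) = 0 := by simpa [I, TwoSidedIdeal.mem_mk'] using h1
  exact h2 (by rw [← ht.map_one, ← h1' 1, mul_one])

variable [StarRing A]

/-- The involution commutes with the reduced trace, because the coefficient `t x` of the
quadratic equation of a noncentral `x` is uniquely determined. -/
theorem trace_star (ht : IsReducedTrace t) (x : A) : t (star x) = star (t x) := by
  by_cases hx : x ∈ Subring.center A
  · rw [ht.map_central hx, ht.map_central (star_mem_center hx), star_mul, star_ofNat, mul_two,
      two_mul]
  obtain ⟨n, hn, h⟩ := ht.mul_self x
  obtain ⟨m, hm, h'⟩ := ht.mul_self (star x)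
  by_contra hne
  have htx := star_mem_center (ht.mem_center x)
  have hk := Subring.sub_mem _ (ht.mem_center (star x)) htx
  obtain ⟨u, hu⟩ := isUnit_of_mem_center hk (sub_ne_zero.2 hne)
  have h1 : star x * star x = star (t x) * star x - star n := by
    rw [← star_mul, h, star_sub, star_mul, Subring.mem_center_iff.1 htx]
  have h2 : u * star x = m - star n := by
    have := h'.symm.trans h1
    rw [hu, sub_mul, sub_eq_iff_eq_add.1 this]
    abel
  have hinv : (↑u⁻¹ : A) ∈ Subring.center A := by
    refine Subring.mem_center_iff.2 fun g => ?_
    have := Subring.mem_center_iff.1 hk g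
    rw [← hu] at this
    rw [← Units.inv_mul_cancel_left u (g * ↑u⁻¹), ← mul_assoc (u : A), ← this, mul_assoc g,
      Units.mul_inv, mul_one]
  have h3 : star x ∈ Subring.center A := by
    rw [← Units.inv_mul_cancel_left u (star x), h2]
    exact Subring.mul_mem _ hinv (Subring.sub_mem _ hm (star_mem_center hn))
  exact hx (star_star x ▸ star_mem_center h3)

/-- If the involution is trivial on the centre then the values of `g` are symmetric, so that
`2 * g x = 0`; otherwise scaling `x` by `k` and comparing gives `(k - star k) * g x = 0`. -/
theorem eq_zero_of_forall_add_star_eq_zero (h2 : IsUnit (2 : A)) {g : A → A}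
    (hmem : ∀ x, g x ∈ Subring.center A)
    (hmul : ∀ k ∈ Subring.center A, ∀ x, g (k * x) = k * g x)
    (h : ∀ x, g x + star (g x) = 0) (x : A) : g x = 0 := by
  by_cases hk : ∀ k ∈ Subring.center A, star k = k
  · have := h x
    rw [hk _ (hmem x), ← two_mul] at this
    exact (h2.mul_right_eq_zero).1 this
  · push Not at hk
    obtain ⟨k, hk, hne⟩ := hk
    have h1 := h (k * x)
    have hs := star_mem_center hk
    rw [hmul k hk, star_mul, Subring.mem_center_iff.1 hs, eq_neg_of_add_eq_zero_right (h x)] at h1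
    have h3 : (k - star k) * g x = 0 := by rw [sub_mul, ← h1, mul_neg, sub_eq_add_neg]
    obtain ⟨u, hu⟩ := isUnit_of_mem_center (Subring.sub_mem _ hk hs) (sub_ne_zero.2 hne.symm)
    rw [← hu] at h3
    exact (u.isUnit.mul_right_eq_zero).1 h3

end Simple

/-! ### Orderings and scalars of prepositive cones -/

namespace RingPreordering

variable {F : Type*} [Field F] {P : RingPreordering F}

theorem two_mem (P : RingPreordering F) : (2 : F) ∈ P := by
  rw [← one_add_one_eq_two]
  exact add_mem (one_mem P) (one_mem P)

theorem two_ne_zero' (P : RingPreordering F) : (2 : F) ≠ 0 := fun h =>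
  P.neg_one_notMem (by
    rw [neg_eq_of_add_eq_zero_right (one_add_one_eq_two.trans h)]
    exact one_mem P)

end RingPreordering

theorem smul_mem_of_scalarSet_eq {F A : Type*} [Field F] [Ring A] [Algebra F A] {C : Set A}
    {P : RingPreordering F} (hCP : scalarSet F C = (P : Set F)) {u : F} (hu : u ∈ P)
    {x : A} (hx : x ∈ C) : u • x ∈ C := by
  have : u ∈ scalarSet F C := by rw [hCP]; exact hu
  exact this x hx

namespace IsPrepositiveCone

variable {F A : Type*} [Field F] [Ring A] [Algebra F A] [StarRing A] {C : Set A}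
  {P : RingPreordering F}

theorem zero_mem (hC : IsPrepositiveCone F C) : (0 : A) ∈ C := by
  have : (0 : A) ∈ C ∩ {x | -x ∈ C} := by rw [hC.inter_neg]; rfl
  exact this.1

theorem eq_zero (hC : IsPrepositiveCone F C) {x : A} (h : x ∈ C) (h' : -x ∈ C) : x = 0 := by
  have : x ∈ C ∩ {x | -x ∈ C} := ⟨h, h'⟩
  rwa [hC.inter_neg] at this

theorem mem_of_smul_mem (hC : IsPrepositiveCone F C) (hP : P.IsOrdering)
    (hCP : scalarSet F C = (P : Set F)) {u : F} {x : A} (hx : x ∈ C) (h0 : x ≠ 0)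
    (h : u • x ∈ C) : u ∈ P := by
  rcases hP.mem_or_neg_mem u with hu | hu
  · exact hu
  have h' := smul_mem_of_scalarSet_eq hCP hu hx
  rw [neg_smul] at h'
  rw [(smul_eq_zero.1 (hC.eq_zero h h')).resolve_right h0]
  exact P.zero_mem

theorem exists_ne_zero (hC : IsPrepositiveCone F C) : ∃ x ∈ C, x ≠ 0 := by
  by_contra! h
  obtain ⟨O, _, hO⟩ := hC.isOrdering
  apply O.neg_one_notMem
  rw [← SetLike.mem_coe, hO]
  intro x hx
  rw [h x hx, smul_zero, ← h x hx]
  exact hx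

/-- A nonzero scalar `u` of the smaller cone whose negative is a scalar of the larger one would
give the larger cone a nonzero element `u • x` together with its negative. -/
theorem scalarSet_eq_of_subset {D : Set A} (hC : IsPrepositiveCone F C) (hP : P.IsOrdering)
    (hCP : scalarSet F C = (P : Set F)) (hD : IsPrepositiveCone F D) (hCD : C ⊆ D) :
    scalarSet F D = (P : Set F) := by
  obtain ⟨Q, hQ, hDQ⟩ := hD.isOrdering
  obtain ⟨x, hx, h0⟩ := hC.exists_ne_zero
  have hPQ : ∀ u ∈ P, u ∈ Q := fun u hu =>
    hD.mem_of_smul_mem hQ hDQ.symm (hCD hx) h0 (hCD (smul_mem_of_scalarSet_eq hCP hu hx))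
  rw [← hDQ]
  refine Set.Subset.antisymm (fun u hu => ?_) hPQ
  rcases hP.mem_or_neg_mem u with h | h
  · exact h
  · rw [RingPreordering.eq_zero_of_mem_of_neg_mem hu (hPQ _ h)]
    exact P.zero_mem

end IsPrepositiveCone

/-! ### The reduced norm form of a cone that contains the unit -/

section UnitMem

variable {F A : Type*} [Field F] [Ring A] [Algebra F A] [StarRing A] {t : A → A}
  {P : RingPreordering F} {C : Set A}

theorem IsAlgebraWithInvolution.star_smul_one (hA : IsAlgebraWithInvolution F A) (u : F) :
    star (u • (1 : A)) = u • (1 : A) := by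
  have : algebraMap F A u ∈ (Subring.center A : Set A) ∩ {x | star x = x} := by
    rw [← hA.range_algebraMap]; exact ⟨u, rfl⟩
  rw [← Algebra.algebraMap_eq_smul_one]
  exact this.2

theorem IsAlgebraWithInvolution.star_smul (hA : IsAlgebraWithInvolution F A) (u : F) (x : A) :
    star (u • x) = u • star x := by
  rw [← one_mul x, ← smul_mul_assoc, star_mul, hA.star_smul_one, mul_smul_comm, mul_one, one_mul]

theorem IsAlgebraWithInvolution.exists_smul_one_eq (hA : IsAlgebraWithInvolution F A) {x : A}
    (hx : x ∈ Subring.center A) (hs : star x = x) : ∃ u : F, x = u • (1 : A) := by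
  have : x ∈ Set.range (algebraMap F A) := by
    rw [hA.range_algebraMap]; exact ⟨hx, hs⟩
  obtain ⟨u, rfl⟩ := this
  exact ⟨u, Algebra.algebraMap_eq_smul_one u⟩

theorem isUnit_two_of_ne_zero (F A : Type*) [Field F] [Ring A] [Algebra F A] (h : (2 : F) ≠ 0) :
    IsUnit (2 : A) := by
  rw [← map_ofNat (algebraMap F A) 2]
  exact (IsUnit.mk0 (2 : F) h).map (algebraMap F A)

theorem exists_eq_smul_one_add (hA : IsAlgebraWithInvolution F A) (ht : IsReducedTrace t)
    (h2 : (2 : F) ≠ 0) {z : A} (hz : star z = z) :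
    ∃ (α : F) (w : A), z = α • (1 : A) + w ∧ star w = w ∧ t w = 0 := by
  have := hA.isSimpleRing
  obtain ⟨u, hu⟩ := hA.exists_smul_one_eq (ht.mem_center z) (by rw [← trace_star ht, hz])
  refine ⟨2⁻¹ * u, z - (2⁻¹ * u) • (1 : A), by abel, ?_, ?_⟩
  · rw [star_sub, hz, hA.star_smul_one]
  · rw [ht.map_sub, ht.map_smul_one, hu, mul_inv_cancel_left₀ h2, sub_self]

/-- The reduced norm form is negative semidefinite on the symmetric elements of trace zero. -/
theorem exists_mul_self_eq_smul_one (hA : IsAlgebraWithInvolution F A) (ht : IsReducedTrace t)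
    (hP : P.IsOrdering) (hC : IsPrepositiveCone F C) (hCP : scalarSet F C = (P : Set F))
    (h1 : (1 : A) ∈ C) {z : A} (hz : star z = z) (htz : t z = 0) :
    ∃ u ∈ P, z * z = u • (1 : A) := by
  have := hA.isSimpleRing
  obtain ⟨n, hn, h⟩ := ht.mul_self z
  rw [htz, zero_mul, zero_sub] at h
  obtain ⟨u, hu⟩ := hA.exists_smul_one_eq (x := z * z) (h ▸ Subring.neg_mem _ hn)
    (by rw [star_mul, hz])
  refine ⟨u, hC.mem_of_smul_mem hP hCP h1 one_ne_zero ?_, hu⟩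
  have := hC.star_mul_mul_mem z 1 h1
  rwa [hz, mul_one, hu] at this

/-- A vector on which a semidefinite quadratic form vanishes lies in the radical of the form. -/
theorem mul_add_mul_eq_zero_of_mul_self_eq_zero (hA : IsAlgebraWithInvolution F A)
    (ht : IsReducedTrace t) (hP : P.IsOrdering) (hC : IsPrepositiveCone F C)
    (hCP : scalarSet F C = (P : Set F)) (h1 : (1 : A) ∈ C) {y z : A}
    (hy : star y = y) (hty : t y = 0) (hyy : y * y = 0) (hz : star z = z) (htz : t z = 0) :
    z * y + y * z = 0 := by
  have := hA.isSimpleRing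
  obtain ⟨q, -, hq⟩ := exists_mul_self_eq_smul_one hA ht hP hC hCP h1 hz htz
  have key : ∀ l : F, ∃ u ∈ P, q • (1 : A) + l • (z * y + y * z) = u • (1 : A) := by
    intro l
    obtain ⟨u, hu, h⟩ := exists_mul_self_eq_smul_one hA ht hP hC hCP h1 (z := z + l • y)
      (by rw [star_add, hA.star_smul, hy, hz]) (by rw [ht.map_add, ht.map_smul, hty, htz]; simp)
    refine ⟨u, hu, ?_⟩
    rw [← h, ← hq]
    simp only [add_mul, mul_add, smul_mul_assoc, mul_smul_comm, hyy, smul_zero, smul_add]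
    abel
  obtain ⟨u, -, hu⟩ := key 1
  have hb : z * y + y * z = (u - q) • (1 : A) := by
    rw [sub_smul, ← hu, one_smul]; abel
  set b := u - q
  rw [hb]
  by_contra h0
  have hb0 : b ≠ 0 := by rintro h; exact h0 (by rw [h, zero_smul])
  obtain ⟨v, hv, h⟩ := key (-(q + 1) * b⁻¹)
  rw [hb, smul_smul, ← add_smul, inv_mul_cancel_right₀ hb0] at h
  have hvv : q + -(q + 1) = v := by
    have : (q + -(q + 1) - v) • (1 : A) = 0 := by rw [sub_smul, h, sub_self]
    exact sub_eq_zero.1 ((smul_eq_zero.1 this).resolve_right one_ne_zero)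
  apply P.neg_one_notMem
  rw [show (-1 : F) = v by rw [← hvv]; ring]
  exact hv

/-- A symmetric element of trace zero and square zero is orthogonal to all symmetric elements for
the trace form. Applied to `x + star x` this makes `t (x * y)` skew for every `x`, hence zero. -/
theorem trace_zero_eq_zero_of_mul_self (hA : IsAlgebraWithInvolution F A)
    (ht : IsReducedTrace t) (hP : P.IsOrdering) (hC : IsPrepositiveCone F C)
    (hCP : scalarSet F C = (P : Set F)) (h1 : (1 : A) ∈ C) {y : A} (hy : star y = y)
    (hty : t y = 0) (hyy : y * y = 0) : y = 0 := by
  have := hA.isSimpleRing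
  have h2 := isUnit_two_of_ne_zero F A P.two_ne_zero'
  have hsym : ∀ z, star z = z → t (z * y) = 0 := by
    intro z hz
    obtain ⟨α, w, rfl, hw, htw⟩ := exists_eq_smul_one_add hA ht P.two_ne_zero' hz
    have h := congrArg t
      (mul_add_mul_eq_zero_of_mul_self_eq_zero hA ht hP hC hCP h1 hy hty hyy hw htw)
    rw [ht.map_add, ht.map_mul_comm y w, ht.map_zero, ← two_mul] at h
    rw [add_mul, ht.map_add, (h2.mul_right_eq_zero).1 h, smul_mul_assoc, one_mul, ht.map_smul, hty,
      smul_zero, add_zero]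
  refine eq_zero_of_forall_trace_mul_eq_zero ht h2.ne_zero
    (eq_zero_of_forall_add_star_eq_zero h2 (fun x => ht.mem_center _)
      (fun k hk x => by rw [mul_assoc, ht.map_mul_left k hk]) fun x => ?_)
  have h := hsym (x + star x) (by rw [star_add, star_star, add_comm])
  rw [add_mul, ht.map_add] at h
  rw [← trace_star ht, star_mul, hy, ht.map_mul_comm y]
  exact h

/-- For skew `w` the commutator of `w` and `d`, and for symmetric `z` the element
`d * z * d - d * d * z`, are symmetric and anticommute with `d`. If all of them vanished then `d`
would be central. -/
theorem exists_anticommuting (hA : IsAlgebraWithInvolution F A) (ht : IsReducedTrace t)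
    (h2 : (2 : F) ≠ 0) {d : A} {δ : F} (hd : star d = d) (htd : t d = 0)
    (hdd : d * d = δ • (1 : A)) (hδ : δ ≠ 0) :
    ∃ y, star y = y ∧ t y = 0 ∧ y * d = -(d * y) ∧ y ≠ 0 := by
  have := hA.isSimpleRing
  have h2A := isUnit_two_of_ne_zero F A h2
  by_contra! hno
  have hskew : ∀ w, star w = -w → w * d = d * w := by
    intro w hw
    refine sub_eq_zero.1 (hno (w * d - d * w) ?_ ?_ ?_)
    · rw [star_sub, star_mul, star_mul, hd, hw]; noncomm_ring
    · rw [ht.map_sub, ht.map_mul_comm w d, sub_self]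
    · rw [sub_mul, mul_sub, mul_assoc w, ← mul_assoc d d, hdd, mul_assoc d w d]
      simp
  have hsym : ∀ z, star z = z → z * d = d * z := by
    intro z hz
    have h : d * z * d - δ • z = 0 := by
      refine hno _ ?_ ?_ ?_
      · rw [star_sub, star_mul, star_mul, hd, hA.star_smul, hz, mul_assoc]
      · rw [ht.map_sub, ht.map_mul_comm, ← mul_assoc, hdd, smul_mul_assoc, one_mul, sub_self]
      · rw [sub_mul, mul_sub, mul_assoc (d * z), hdd, ← mul_assoc d (d * z) d, ← mul_assoc d d z,
          hdd]
        simp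
    have h' := congrArg (d * ·) (sub_eq_zero.1 h)
    simp only [mul_assoc, mul_smul_comm] at h'
    rw [← mul_assoc d d, hdd, smul_mul_assoc, one_mul] at h'
    exact smul_right_injective A hδ h'
  have hcen : d ∈ Subring.center A := by
    refine Subring.mem_center_iff.2 fun x => (h2A.mul_right_injective ?_)
    have h3 := hsym (x + star x) (by rw [star_add, star_star, add_comm])
    have h4 := hskew (x - star x) (by rw [star_sub, star_star, neg_sub])
    rw [add_mul, mul_add] at h3
    rw [sub_mul, mul_sub] at h4
    simp only [two_mul]
    have h5 := congrArg₂ (· + ·) h3 h4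
    calc x * d + x * d = x * d + star x * d + (x * d - star x * d) := by abel
      _ = d * x + d * x := by rw [h5]; abel
  have hd0 : d = 0 := by
    rw [ht.map_central hcen] at htd
    exact (h2A.mul_right_eq_zero).1 htd
  rw [hd0, zero_mul, eq_comm, smul_eq_zero] at hdd
  exact hδ (hdd.resolve_right one_ne_zero)

end UnitMem

/-! ### Maximality -/

section Maximality

variable {F A : Type*} [Field F] [Ring A] [Algebra F A] [StarRing A] {t : A → A}
  {P : RingPreordering F} {C D : Set A}

/-- With `d = α + e`, where `e` has trace zero and square `δ`, the reduced norm `α ^ 2 - δ` of an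
element of a cone that contains `1` is nonnegative. Otherwise conjugation by a trace zero `y`
orthogonal to `e` shows that the cone is stable under `e ↦ -e`, so that the scalar parts of its
elements are nonnegative; but `star x * d * x` has a negative scalar part for
`x = α • e - δ • 1`. -/
theorem sq_sub_mem_of_mem (hA : IsAlgebraWithInvolution F A) (ht : IsReducedTrace t)
    (hP : P.IsOrdering) (hD : IsPrepositiveCone F D) (hDP : scalarSet F D = (P : Set F))
    (h1 : (1 : A) ∈ D) {α δ : F} {e : A} (he : star e = e) (hte : t e = 0)
    (hee : e * e = δ • (1 : A)) (hd : α • (1 : A) + e ∈ D) : α * α - δ ∈ P := by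
  have := hA.isSimpleRing
  rcases hP.mem_or_neg_mem (α * α - δ) with h | hneg
  · exact h
  by_cases he0 : e = 0
  · have hδ : δ = 0 := by
      rw [he0, zero_mul, eq_comm, smul_eq_zero] at hee
      exact hee.resolve_right one_ne_zero
    rw [hδ, sub_zero]
    exact P.mul_self_mem α
  have hδ : δ ≠ 0 := by
    rintro rfl
    exact he0 (trace_zero_eq_zero_of_mul_self hA ht hP hD hDP h1 he hte
      (by rw [hee, zero_smul]))
  have hδP : δ ∈ P := by
    obtain ⟨u, hu, h⟩ := exists_mul_self_eq_smul_one hA ht hP hD hDP h1 he hte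
    have h0 : (δ - u) • (1 : A) = 0 := by rw [sub_smul, ← hee, h, sub_self]
    rwa [sub_eq_zero.1 ((smul_eq_zero.1 h0).resolve_right one_ne_zero)]
  obtain ⟨y, hy, hty, hanti, hy0⟩ := exists_anticommuting hA ht P.two_ne_zero' he hte hee hδ
  obtain ⟨v, hv, hyy⟩ := exists_mul_self_eq_smul_one hA ht hP hD hDP h1 hy hty
  have hv0 : v ≠ 0 := by
    rintro rfl
    exact hy0 (trace_zero_eq_zero_of_mul_self hA ht hP hD hDP h1 hy hty
      (by rw [hyy, zero_smul]))
  have hconj : ∀ β γ : F, β • (1 : A) + γ • e ∈ D → β • (1 : A) - γ • e ∈ D := by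
    intro β γ h
    have h3 := smul_mem_of_scalarSet_eq hDP (RingPreordering.inv_mem hv)
      (hD.star_mul_mul_mem y _ h)
    have h4 : star y * (β • (1 : A) + γ • e) * y = v • (β • (1 : A) - γ • e) := by
      rw [hy, mul_add, mul_smul_comm, mul_smul_comm, hanti, mul_one, add_mul, smul_mul_assoc,
        smul_mul_assoc, neg_mul, mul_assoc, hyy]
      simp only [mul_smul_comm, mul_one]
      module
    rwa [h4, smul_smul, inv_mul_cancel₀ hv0, one_smul] at h3
  have hscal : ∀ β γ : F, β • (1 : A) + γ • e ∈ D → β ∈ P := by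
    intro β γ h
    have h3 := hD.add_mem _ h _ (hconj β γ h)
    rw [show β • (1 : A) + γ • e + (β • (1 : A) - γ • e) = (2 * β) • (1 : A) by module] at h3
    have h4 := hD.mem_of_smul_mem hP hDP h1 one_ne_zero h3
    have h5 := mul_mem (RingPreordering.inv_mem P.two_mem) h4
    rwa [inv_mul_cancel_left₀ P.two_ne_zero'] at h5
  have hd' : α • (1 : A) + (1 : F) • e ∈ D := by rwa [one_smul]
  have hα := hscal α 1 hd'
  have hx := hD.star_mul_mul_mem (α • e - δ • (1 : A)) _ hd
  have hcalc : star (α • e - δ • (1 : A)) * (α • (1 : A) + e) * (α • e - δ • (1 : A)) =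
      ((α * α - δ) * (α * δ)) • (1 : A) + (-((α * α - δ) * δ)) • e := by
    have h3 : (α • e - δ • (1 : A)) * (α • (1 : A) + e) = (α * α - δ) • e := by
      simp only [sub_mul, mul_add, smul_mul_assoc, mul_smul_comm, mul_one, one_mul, hee]
      module
    rw [star_sub, hA.star_smul, he, hA.star_smul_one, h3]
    simp only [mul_sub, smul_mul_assoc, mul_smul_comm, mul_one, hee]
    module
  rw [hcalc] at hx
  have h3 := RingPreordering.eq_zero_of_mem_of_neg_mem (hscal _ _ hx)
    (by rw [← neg_mul]; exact mul_mem hneg (mul_mem hα hδP))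
  rcases mul_eq_zero.1 h3 with h4 | h4
  · rw [h4]; exact P.zero_mem
  · exfalso
    rw [(mul_eq_zero.1 h4).resolve_right hδ, zero_smul, zero_add] at hd
    refine he0 (hD.eq_zero hd ?_)
    simpa using hconj 0 1 (by simpa using hd)

/-- An element `d = α + e` of nonnegative reduced norm satisfies `2 α d = d ^ 2 + (α ^ 2 - δ)`, so
that `2 α d` lies in every cone that contains `1`. -/
theorem subset_of_one_mem (hA : IsAlgebraWithInvolution F A) (ht : IsReducedTrace t)
    (hP : P.IsOrdering) (hC : IsPrepositiveCone F C) (hCP : scalarSet F C = (P : Set F))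
    (hD : IsPrepositiveCone F D) (hCD : C ⊆ D) (h1 : (1 : A) ∈ C) : D ⊆ C := by
  have := hA.isSimpleRing
  have hDP := hC.scalarSet_eq_of_subset hP hCP hD hCD
  intro d hd
  have hds := hD.isSymm d hd
  obtain ⟨α, e, rfl, he, hte⟩ := exists_eq_smul_one_add hA ht P.two_ne_zero' hds
  obtain ⟨δ, hδ, hee⟩ := exists_mul_self_eq_smul_one hA ht hP hC hCP h1 he hte
  have hnorm := sq_sub_mem_of_mem hA ht hP hD hDP (hCD h1) he hte hee hd
  by_cases hα : α = 0
  · subst hα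
    rw [mul_zero, zero_sub] at hnorm
    rw [RingPreordering.eq_zero_of_mem_of_neg_mem hδ hnorm, zero_smul] at hee
    rw [trace_zero_eq_zero_of_mul_self hA ht hP hC hCP h1 he hte hee, zero_smul,
      zero_add]
    exact hC.zero_mem
  set d := α • (1 : A) + e with hdef
  have h2α : (2 * α) • d ∈ C := by
    have h3 := hC.star_mul_mul_mem d 1 h1
    have h4 : (2 * α) • d = star d * 1 * d + (α * α - δ) • (1 : A) := by
      rw [hds, mul_one, hdef]
      simp only [add_mul, mul_add, smul_mul_assoc, mul_smul_comm, mul_one, one_mul, hee]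
      module
    rw [h4]
    exact hC.add_mem _ h3 _ (smul_mem_of_scalarSet_eq hCP hnorm h1)
  have h20 : (2 * α) ≠ 0 := mul_ne_zero P.two_ne_zero' hα
  rcases hP.mem_or_neg_mem (2 * α) with h | h
  · have h3 := smul_mem_of_scalarSet_eq hCP (RingPreordering.inv_mem h) h2α
    rwa [smul_smul, inv_mul_cancel₀ h20, one_smul] at h3
  · have h3 := smul_mem_of_scalarSet_eq hCP (RingPreordering.inv_mem h) h2α
    rw [smul_smul, inv_neg, neg_mul, inv_mul_cancel₀ h20, neg_smul, one_smul] at h3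
    rw [hD.eq_zero hd (hCD h3)]
    exact hC.zero_mem

/-- If `c + star x * c * x` is never invertible, then comparing reduced norms gives
`t ((t c - c) * star x * c * x) = 0` for all `x`. The polarization of this identity is a skew form
that is linear over the centre in one variable, hence zero, and therefore
`(t c - c) * x * c = 0` for all `x`, which is impossible in a simple ring as `t c - c` and `c` are
nonzero. -/
theorem exists_isUnit_mem (hA : IsAlgebraWithInvolution F A) (ht : IsReducedTrace t)
    (h2 : (2 : F) ≠ 0) (hC : IsPrepositiveCone F C) : ∃ c ∈ C, IsUnit c := by
  have := hA.isSimpleRing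
  have h2A := isUnit_two_of_ne_zero F A h2
  by_contra! hno
  obtain ⟨c, hc, hc0⟩ := hC.exists_ne_zero
  have hcs := hC.isSymm c hc
  set k := t c with hk
  have hkc : k ∈ Subring.center A := ht.mem_center c
  have hks : star k = k := by rw [hk, ← trace_star ht, hcs]
  have hq : ∀ x, t ((k - c) * (star x * c * x)) = 0 := by
    intro x
    set b := star x * c * x with hb
    have hbC : b ∈ C := hC.star_mul_mul_mem x c hc
    have e1 := mul_self_eq_of_not_isUnit ht (hno c hc)
    have e2 := mul_self_eq_of_not_isUnit ht (hno b hbC)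
    have e3 := mul_self_eq_of_not_isUnit ht (hno _ (hC.add_mem c hc b hbC))
    have e4 : c * b + b * c = k * b + t b * c := by
      rw [ht.map_add] at e3
      simp only [add_mul, mul_add, e1, e2] at e3
      rw [← sub_eq_zero] at e3 ⊢
      rw [← e3]
      abel
    have e5 := congrArg t e4
    rw [ht.map_add, ht.map_add, ht.map_mul_comm b c, ht.map_mul_left k hkc,
      ht.map_mul_left _ (ht.mem_center b), ← hk, Subring.mem_center_iff.1 hkc (t b), ← two_mul,
      ← two_mul] at e5
    rw [sub_mul, ht.map_sub, ht.map_mul_left k hkc, sub_eq_zero]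
    exact (h2A.mul_right_injective e5).symm
  have hpol : ∀ x y, t ((k - c) * (star x * c * y)) + t ((k - c) * (star y * c * x)) = 0 := by
    intro x y
    have h := hq (x + y)
    rw [star_add, show (k - c) * ((star x + star y) * c * (x + y)) =
      (k - c) * (star x * c * x) + (k - c) * (star y * c * y) +
      ((k - c) * (star x * c * y) + (k - c) * (star y * c * x)) by noncomm_ring, ht.map_add,
      ht.map_add, hq x, hq y, add_zero, zero_add, ht.map_add] at h
    exact h
  have hform : ∀ x y, t ((k - c) * (star x * c * y)) = 0 := by
    intro x
    refine eq_zero_of_forall_add_star_eq_zero h2A (fun y => ht.mem_center _)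
      (fun l hl y => ?_) fun y => ?_
    · rw [← ht.map_mul_left l hl]
      congr 1
      simp only [← mul_assoc]
      rw [Subring.mem_center_iff.1 hl]
      simp only [mul_assoc]
    · rw [← trace_star ht, ← hpol x y]
      congr 1
      rw [star_mul, star_mul, star_mul, star_star, star_sub, hks, hcs, ht.map_mul_comm, mul_assoc]
  have hzero : ∀ x, (k - c) * x * c = 0 := by
    intro x
    refine eq_zero_of_forall_trace_mul_eq_zero ht h2A.ne_zero fun y => ?_
    rw [ht.map_mul_comm, ← hform (star x) y, star_star]
    simp only [mul_assoc]
  by_cases hkc0 : k - c = 0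
  · rw [← sub_eq_zero.1 hkc0] at hc0
    apply hno c hc
    rw [← sub_eq_zero.1 hkc0]
    exact isUnit_of_mem_center hkc hc0
  · exact hc0 (IsSimpleRing.eq_zero_of_forall_mul_mul_eq_zero hzero hkc0)

end Maximality

/-! ### Scaling by a symmetric unit -/

theorem scalarSet_preimage_mul_left {F A : Type*} [Field F] [Ring A] [Algebra F A] (c : Aˣ)
    (C : Set A) : scalarSet F {x : A | (c : A) * x ∈ C} = scalarSet F C := by
  ext u
  refine ⟨fun h x hx => ?_, fun h x hx => ?_⟩
  · have := h (↑c⁻¹ * x) (by simpa using hx)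
    simpa using this
  · have := h _ hx
    simpa using this

section Scaling

variable {F A : Type*} [Field F] [Ring A] [Algebra F A] [StarRing A]

/-- For a symmetric unit `c`, the involution `x ↦ c⁻¹ * star x * c`. -/
abbrev conjStarRing (c : Aˣ) (hc : star (c : A) = c) : StarRing A where
  star x := ↑c⁻¹ * star x * c
  star_involutive x := by
    have hinv : star (↑c⁻¹ : A) * c = 1 := by
      rw [← hc, ← star_mul, Units.mul_inv, star_one]
    change ↑c⁻¹ * star (↑c⁻¹ * star x * c) * c = x
    rw [star_mul, star_mul, star_star, hc, mul_assoc, mul_assoc, mul_assoc, hinv, mul_one,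
      Units.inv_mul_cancel_left]
  star_mul x y := by simp [mul_assoc]
  star_add x y := by simp [mul_add, add_mul]

theorem conjStarRing_isAlgebraWithInvolution (hA : IsAlgebraWithInvolution F A) (c : Aˣ)
    (hc : star (c : A) = c) : @IsAlgebraWithInvolution F A _ _ _ (conjStarRing c hc) := by
  refine @IsAlgebraWithInvolution.mk F A _ _ _ (conjStarRing c hc) hA.finiteDimensional
    hA.isSimpleRing ?_
  rw [hA.range_algebraMap]
  ext x
  refine and_congr_right fun hx => ?_
  have : ↑c⁻¹ * star x * c = star x := by
    rw [Subring.mem_center_iff.1 (star_mem_center hx), mul_assoc, Units.inv_mul, mul_one]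
  change star x = x ↔ ↑c⁻¹ * star x * c = x
  rw [this]

/-- Multiplication by `c` turns cones for the involution `x ↦ c⁻¹ * star x * c` into cones for the
given involution. -/
theorem IsPrepositiveCone.preimage_mul_left {C : Set A} (hC : IsPrepositiveCone F C) (c : Aˣ)
    (hc : star (c : A) = c) :
    @IsPrepositiveCone F A _ _ _ (conjStarRing c hc) {x | (c : A) * x ∈ C} := by
  refine @IsPrepositiveCone.mk F A _ _ _ (conjStarRing c hc) _ ?_ ?_ ?_ ?_ ?_ ?_
  · intro x hx
    have := hC.isSymm _ hx
    rw [star_mul, hc] at this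
    change ↑c⁻¹ * star x * c = x
    rw [mul_assoc, this, Units.inv_mul_cancel_left]
  · obtain ⟨x, hx⟩ := hC.nonempty
    exact ⟨↑c⁻¹ * x, by simpa using hx⟩
  · intro x hx y hy
    change c * (x + y) ∈ C
    rw [mul_add]
    exact hC.add_mem _ hx _ hy
  · intro a x hx
    change c * (↑c⁻¹ * star a * c * x * a) ∈ C
    have := hC.star_mul_mul_mem a _ hx
    simpa [mul_assoc] using this
  · rw [scalarSet_preimage_mul_left]
    exact hC.isOrdering
  · ext x
    refine ⟨fun h => ?_, ?_⟩
    · have h0 := hC.eq_zero h.1 (by rw [← mul_neg]; exact h.2)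
      exact (Units.mul_right_eq_zero c).1 h0
    · rintro rfl
      simpa using hC.zero_mem

end Scaling

theorem theorem5p1 {F A R : Type*} [Field F] [Ring A] [Algebra F A] [StarRing A]
    (hA : IsQuaternionAlgebraWithInvolution F A)
    (P : RingPreordering F) (hP : P.IsOrdering)
    [Field R] [LinearOrder R] [IsStrictOrderedRing R] [Algebra F R]
    [TopologicalSpace R] [OrderTopology R]
    (hR : IsRealClosure P R) (hdense : DenseRange (algebraMap F R))
    (C : Set A) (hC : IsPrepositiveCone F C) (hCP : scalarSet F C = (P : Set F)) :
    IsPositiveCone F C := by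
  refine ⟨hC, fun D hD hCD d hd => ?_⟩
  have hA' := hA.toIsAlgebraWithInvolution
  have := hA.isSimpleRing
  have h2 : (2 : F) ≠ 0 := P.two_ne_zero'
  obtain ⟨t, ht⟩ :=
    exists_isReducedTrace (isUnit_two_of_ne_zero F A h2).ne_zero hA.finrank_center
  obtain ⟨_, hcC, c, rfl⟩ := exists_isUnit_mem hA' ht h2 hC
  have hc := hC.isSymm _ hcC
  have key := @subset_of_one_mem F A _ _ _ (conjStarRing c hc) t P _ _
    (conjStarRing_isAlgebraWithInvolution hA' c hc) ht hP (hC.preimage_mul_left c hc)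
    (by rw [scalarSet_preimage_mul_left, hCP]) (hD.preimage_mul_left c hc)
    (fun x hx => hCD hx) (by simpa using hcC)
  have hmem : (↑c⁻¹ * d : A) ∈ {x | (c : A) * x ∈ C} := key (by simpa using hd)
  simpa using hmem
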